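/- Let $\Omega\subset\mathbb{R}^n$ be measurable, let $\omega$ be a positive function on $\Omega$, and put $I[f]=\int_\Omega \omega(\mathbf{x})f(\mathbf{x})\,d\mathbf{x}$. Let $V\subset R=\mathbb{R}[x_1,\dots,x_n]$ be a finite-dimensional vector space of polynomials $v$ for which $\omega v$ is integrable on $\Omega$. A set $B$ of monomials is connected to $1$ if $1\in B$ and every $m\in B$ with $m\neq 1$ has the form $m=x_i m'$ with $1\le i\le n$ and $m'\in B$; put $B^+=B\cup x_1B\cup\cdots\cup x_nB$. Write $\langle S\rangle$ for the linear span of $S$, and for a linear form $\sigma$ on $\langle B^+\cdot B^+\rangle$ and $C\in\{B,B^+\}$ let $H_\sigma^{C,C}$ be the bilinear form $(p,q)\mapsto\sigma(pq)$ on $\langle C\rangle\times\langle C\rangle$. Suppose that $B$ is a finite set of $r$ monomials connected to $1$ with $V\subset\langle B^+\cdot B^+\rangle$, and that $\sigma$ is a linear form on $\langle B^+\cdot B^+\rangle$ such that $\sigma(v)=I[v]$ for all $v\in V$, $$\operatorname{rank}H_\sigma^{B,B}=\operatorname{rank}H_\sigma^{B^+,B^+}=|B|=r,$$ and $H_\sigma^{B,B}\succcurlyeq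 0$, that is, $\sigma(p^2)\ge 0$ for all $p\in\langle B\rangle$. Then there exist weights $w_1,\dots,w_r>0$ and pairwise distinct points $\zeta_1,\dots,\zeta_r\in\mathbb{R}^n$ such that $$I[v]=\sum_{i=1}^r w_i\,v(\zeta_i)\qquad\text{for all } v\in V.$$ -/

import Mathlib

open MeasureTheory

/-- The weighted integral `I[f] = ∫_Ω w(x) f(x) dx` over `Ω ⊆ ℝⁿ` (Lebesgue measure). -/
noncomputable def weightedIntegral {n : ℕ} (Ω : Set (Fin n → ℝ)) (w : (Fin n → ℝ) → ℝ)
    (f : (Fin n → ℝ) → ℝ) : ℝ :=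
  ∫ x in Ω, w x * f x

namespace MonomialSet

variable {n : ℕ}

/-- A set of monomials of `ℝ[x₁, …, xₙ]`, given by its exponents, is connected to `1` if it
contains `1` and every monomial `m ≠ 1` in it has the form `xᵢ m'` with `m'` in the set. -/
def ConnectedToOne (B : Finset (Fin n →₀ ℕ)) : Prop :=
  0 ∈ B ∧ ∀ m ∈ B, m ≠ 0 → ∃ i : Fin n, ∃ m' ∈ B, m = Finsupp.single i 1 + m'

/-- `B⁺ = B ∪ x₁ B ∪ ⋯ ∪ xₙ B`. -/
noncomputable def plus (B : Finset (Fin n →₀ ℕ)) : Finset (Fin n →₀ ℕ) :=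
  B ∪ Finset.univ.biUnion fun i : Fin n => B.image fun m => Finsupp.single i 1 + m

/-- The linear span `⟨B⟩` of a set of monomials. -/
noncomputable def span (B : Finset (Fin n →₀ ℕ)) : Submodule ℝ (MvPolynomial (Fin n) ℝ) :=
  Submodule.span ℝ ((fun m => MvPolynomial.monomial m (1 : ℝ)) '' (B : Set (Fin n →₀ ℕ)))

/-- The space `⟨B · C⟩` spanned by the products of elements of `B` with elements of `C`. -/
noncomputable def prodSpan (B C : Finset (Fin n →₀ ℕ)) : Submodule ℝ (MvPolynomial (Fin n) ℝ) :=
  span B * span C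

theorem subset_plus (B : Finset (Fin n →₀ ℕ)) : B ⊆ plus B :=
  Finset.subset_union_left

theorem prodSpan_mono {B B' C C' : Finset (Fin n →₀ ℕ)} (hB : B ⊆ B') (hC : C ⊆ C') :
    prodSpan B C ≤ prodSpan B' C' :=
  mul_le_mul'
    (Submodule.span_mono (Set.image_mono (Finset.coe_subset.mpr hB)))
    (Submodule.span_mono (Set.image_mono (Finset.coe_subset.mpr hC)))

/-- The truncated Hankel operator `H_σ^{B,C} : ⟨B⟩ → ⟨C⟩*`, `p ↦ (q ↦ σ(p q))`, equivalently the
bilinear form `(p, q) ↦ σ(p q)` on `⟨B⟩ × ⟨C⟩`, of a linear form `σ` defined on a space `U`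
that contains `⟨B · C⟩`. -/
noncomputable def hankel {U : Submodule ℝ (MvPolynomial (Fin n) ℝ)} (σ : Module.Dual ℝ U)
    (B C : Finset (Fin n →₀ ℕ)) (h : prodSpan B C ≤ U) :
    span B →ₗ[ℝ] Module.Dual ℝ (span C) :=
  LinearMap.mk₂ ℝ
    (fun p q => σ ⟨(p : MvPolynomial (Fin n) ℝ) * q, h (Submodule.mul_mem_mul p.2 q.2)⟩)
    (fun p p' q => by rw [← map_add]; congr 1; ext1; simp [add_mul])
    (fun c p q => by rw [← map_smul]; congr 1; ext1; simp)
    (fun p q q' => by rw [← map_add]; congr 1; ext1; simp [mul_add])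
    (fun c p q => by rw [← map_smul]; congr 1; ext1; simp)

end MonomialSet

/-! By the rank conditions and positivity, `H` = $H_\sigma^{B,B}$ is an inner product on ⟨B⟩, and
⟨B⁺⟩ is the direct sum of ⟨B⟩ and the kernel of `H'` = $H_\sigma^{B^+,B^+}$. Let `π` be the
projection onto ⟨B⟩ (`exists_projection_of_finrank_range_le`). The operators `π ∘ xᵢ` on ⟨B⟩ are
self-adjoint and commute, so the spectral theorem gives an orthonormal joint eigenbasis `b k` with
real joint eigenvalues `ζ k`, the nodes. As B is connected to 1, the coordinates of `π p` are `p (ζ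
k) * c k`, with `c k` those of 1 (`repr_projection_eq_eval_mul`). Hence σ(pq) = H(πp, πq) = ∑ c_k²
p(ζ_k) q(ζ_k), with weights c_k². -/

/-! ### Linear algebra of positive definite forms -/

open Module in
/-- Commuting operators that are self-adjoint for a positive definite symmetric form have a common
orthonormal eigenbasis. -/
theorem LinearMap.exists_orthonormal_joint_eigenbasis {S ι : Type*} [AddCommGroup S] [Module ℝ S]
    [FiniteDimensional ℝ S] {d : ℕ} (hd : finrank ℝ S = d)
    (β : S →ₗ[ℝ] S →ₗ[ℝ] ℝ) (hsymm : ∀ x y, β x y = β y x)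
    (hnonneg : ∀ x, 0 ≤ β x x) (hdef : ∀ x, β x x = 0 → x = 0)
    (T : ι → S →ₗ[ℝ] S) (hT : ∀ i x y, β (T i x) y = β x (T i y))
    (hcomm : ∀ i j x, T i (T j x) = T j (T i x)) :
    ∃ (b : Basis (Fin d) ℝ S) (ζ : Fin d → ι → ℝ),
      (∀ k l, β (b k) (b l) = if k = l then 1 else 0) ∧ ∀ k i, T i (b k) = ζ k i • b k := by
  classical
  let core : InnerProductSpace.Core ℝ S :=
    { inner := fun x y => β x y
      conj_inner_symm := fun x y => by simpa using hsymm y x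
      re_inner_nonneg := fun x => by simpa using hnonneg x
      add_left := fun x y z => by simp
      smul_left := fun x y c => by simp
      definite := hdef }
  let _ : NormedAddCommGroup S := core.toNormedAddCommGroup
  let _ : InnerProductSpace ℝ S := InnerProductSpace.ofCore core.toCore
  have hTs : ∀ i, (T i).IsSymmetric := fun i x y => hT i x y
  have hint := LinearMap.IsSymmetric.directSum_isInternal_of_pairwise_commute hTs
    fun i j _ => LinearMap.ext fun x => hcomm i j x
  let v := hint.collectedBasis fun α =>
    (stdOrthonormalBasis ℝ (⨅ j, End.eigenspace (T j) (α j) : Submodule ℝ S)).toBasis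
  have hv : Orthonormal ℝ v := DirectSum.IsInternal.collectedBasis_orthonormal
    (LinearMap.IsSymmetric.orthogonalFamily_iInf_eigenspaces hTs) hint fun α => by simp
  have := FiniteDimensional.fintypeBasisIndex v
  let e := Fintype.equivFinOfCardEq ((finrank_eq_card_basis v).symm.trans hd)
  refine ⟨v.reindex e, fun k => (e.symm k).1, fun k l => ?_, fun k i => ?_⟩
  · have := orthonormal_iff_ite.mp hv (e.symm k) (e.symm l)
    rw [Basis.reindex_apply, Basis.reindex_apply]
    exact this.trans (by simp)
  · have := hint.collectedBasis_mem (fun α =>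
      (stdOrthonormalBasis ℝ (⨅ j, End.eigenspace (T j) (α j) : Submodule ℝ S)).toBasis) (e.symm k)
    rw [Basis.reindex_apply]
    exact End.mem_eigenspace_iff.mp ((Submodule.mem_iInf _).mp this i)

open Module in
/-- If a form of rank at most `dim S` is definite on `S`, then its domain projects onto `S` along
its kernel. -/
theorem LinearMap.exists_projection_of_finrank_range_le {S P : Type*} [AddCommGroup S] [Module ℝ S]
    [AddCommGroup P] [Module ℝ P] [FiniteDimensional ℝ S] [FiniteDimensional ℝ P]
    (β : P →ₗ[ℝ] Dual ℝ P) (ι : S →ₗ[ℝ] P) (hdef : ∀ s, β (ι s) (ι s) = 0 → s = 0)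
    (hrank : finrank ℝ (LinearMap.range β) ≤ finrank ℝ S) :
    ∃ π : P →ₗ[ℝ] S, (∀ s, π (ι s) = s) ∧ ∀ p, β (ι (π p)) = β p := by
  have hι : Function.Injective ι := (injective_iff_map_eq_zero ι).mpr fun s hs =>
    hdef s (by simp [hs])
  have hdisj : Disjoint (LinearMap.range ι) (LinearMap.ker β) := by
    rw [Submodule.disjoint_def]
    rintro _ ⟨s, rfl⟩ hs
    rw [hdef s (by rw [LinearMap.mem_ker.mp hs]; rfl), map_zero]
  have hcompl : IsCompl (LinearMap.range ι) (LinearMap.ker β) := by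
    -- Rank-nullity: the kernel has codimension at most `finrank S`, so the two disjoint subspaces
    -- fill `P`.
    refine ⟨hdisj, codisjoint_iff.mpr (Submodule.eq_top_of_disjoint _ _ ?_ hdisj)⟩
    rw [LinearMap.finrank_range_of_inj hι]
    have := β.finrank_range_add_finrank_ker
    omega
  refine ⟨LinearMap.linearProjOfIsCompl (LinearMap.ker β) ι hι hcompl, fun s => by simp,
    fun p => ?_⟩
  obtain ⟨_, ⟨s, rfl⟩, k, hk, rfl⟩ := Submodule.mem_sup.mp
    (hcompl.sup_eq_top ▸ Submodule.mem_top : p ∈ LinearMap.range ι ⊔ LinearMap.ker β)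
  rw [map_add, LinearMap.linearProjOfIsCompl_apply_left,
    LinearMap.linearProjOfIsCompl_apply_right' _ _ _ _ _ hk, add_zero, map_add,
    LinearMap.mem_ker.mp hk, add_zero]

/-! ### Spans of monomials and Hankel forms -/

namespace MonomialSet

open Module

variable {n : ℕ}

instance (B : Finset (Fin n →₀ ℕ)) : FiniteDimensional ℝ (span B) :=
  FiniteDimensional.span_of_finite ℝ (B.finite_toSet.image _)

theorem finrank_span_le (B : Finset (Fin n →₀ ℕ)) : finrank ℝ (span B) ≤ B.card := by
  classical
  have := finrank_span_finset_le_card (R := ℝ)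
    (B.image fun m => MvPolynomial.monomial m (1 : ℝ))
  rw [Finset.coe_image] at this
  exact this.trans Finset.card_image_le

theorem span_mono {B C : Finset (Fin n →₀ ℕ)} (h : B ⊆ C) : span B ≤ span C :=
  Submodule.span_mono (Set.image_mono (Finset.coe_subset.mpr h))

theorem monomial_mem_span {B : Finset (Fin n →₀ ℕ)} {m : Fin n →₀ ℕ} (hm : m ∈ B) :
    MvPolynomial.monomial m (1 : ℝ) ∈ span B :=
  Submodule.subset_span ⟨m, hm, rfl⟩

theorem single_add_mem_plus {B : Finset (Fin n →₀ ℕ)} {m : Fin n →₀ ℕ} (hm : m ∈ B) (i : Fin n) :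
    Finsupp.single i 1 + m ∈ plus B := by
  simp only [plus, Finset.mem_union, Finset.mem_biUnion, Finset.mem_image]
  exact Or.inr ⟨i, Finset.mem_univ i, m, hm, rfl⟩

theorem monomial_single_add (i : Fin n) (m : Fin n →₀ ℕ) :
    MvPolynomial.monomial (Finsupp.single i 1 + m) (1 : ℝ) =
      MvPolynomial.X i * MvPolynomial.monomial m 1 := by
  rw [MvPolynomial.X, MvPolynomial.monomial_mul, one_mul]

theorem X_mul_mem_span_plus {B : Finset (Fin n →₀ ℕ)} {p : MvPolynomial (Fin n) ℝ}
    (hp : p ∈ span B) (i : Fin n) : MvPolynomial.X i * p ∈ span (plus B) := by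
  induction hp using Submodule.span_induction with
  | mem x hx =>
    obtain ⟨m, hm, rfl⟩ := hx
    simpa only [monomial_single_add] using monomial_mem_span (single_add_mem_plus hm i)
  | zero => simp
  | add x y _ _ hx hy => rw [mul_add]; exact add_mem hx hy
  | smul c x _ hx => rw [mul_smul_comm]; exact Submodule.smul_mem _ c hx

/-- Multiplication by the variable `xᵢ` as a map `⟨B⟩ → ⟨B⁺⟩`. -/
noncomputable def mulX (B : Finset (Fin n →₀ ℕ)) (i : Fin n) : span B →ₗ[ℝ] span (plus B) :=
  (LinearMap.mulLeft ℝ (MvPolynomial.X i : MvPolynomial (Fin n) ℝ)).restrict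
    fun _ hp => X_mul_mem_span_plus hp i

@[simp]
theorem coe_mulX (B : Finset (Fin n →₀ ℕ)) (i : Fin n) (p : span B) :
    (mulX B i p : MvPolynomial (Fin n) ℝ) =
      MvPolynomial.X i * (p : MvPolynomial (Fin n) ℝ) := rfl

/-- The inclusion `⟨B⟩ → ⟨B⁺⟩`. -/
noncomputable def inclPlus (B : Finset (Fin n →₀ ℕ)) : span B →ₗ[ℝ] span (plus B) :=
  Submodule.inclusion (span_mono (subset_plus B))

@[simp]
theorem coe_inclPlus (B : Finset (Fin n →₀ ℕ)) (p : span B) :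
    (inclPlus B p : MvPolynomial (Fin n) ℝ) = p := rfl

theorem hankel_apply {U : Submodule ℝ (MvPolynomial (Fin n) ℝ)} (σ : Dual ℝ U)
    (B C : Finset (Fin n →₀ ℕ)) (h : prodSpan B C ≤ U) (p : span B) (q : span C) :
    hankel σ B C h p q =
      σ ⟨(p : MvPolynomial (Fin n) ℝ) * q, h (Submodule.mul_mem_mul p.2 q.2)⟩ := rfl

/-- The form sees only the product of its arguments, so symmetry, self-adjointness and commutation
all reduce to identities between polynomials. -/
theorem hankel_congr {U : Submodule ℝ (MvPolynomial (Fin n) ℝ)} (σ : Dual ℝ U)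
    {B C B' C' : Finset (Fin n →₀ ℕ)} (h : prodSpan B C ≤ U) (h' : prodSpan B' C' ≤ U)
    {p : span B} {q : span C} {p' : span B'} {q' : span C'}
    (heq : (p : MvPolynomial (Fin n) ℝ) * q = p' * q') :
    hankel σ B C h p q = hankel σ B' C' h' p' q' := by
  simp only [hankel_apply, heq]

/-- A positive semidefinite Hankel operator on `⟨B⟩` of rank `|B|` is definite. -/
theorem hankel_definite {U : Submodule ℝ (MvPolynomial (Fin n) ℝ)} (σ : Dual ℝ U)
    {B : Finset (Fin n →₀ ℕ)} (h : prodSpan B B ≤ U)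
    (hrank : (hankel σ B B h).rank = B.card) (hpos : ∀ p, 0 ≤ hankel σ B B h p p)
    (p : span B) (hp : hankel σ B B h p p = 0) : p = 0 := by
  have hr : finrank ℝ (LinearMap.range (hankel σ B B h)) = B.card :=
    finrank_eq_of_rank_eq hrank
  have hker : LinearMap.ker (hankel σ B B h) = ⊥ := by
    rw [← Submodule.finrank_eq_zero]
    have := (hankel σ B B h).finrank_range_add_finrank_ker
    have := finrank_span_le B
    omega
  rw [← LinearMap.mem_ker, ← Submodule.mem_bot ℝ, ← hker, LinearMap.mem_ker] at *
  ext q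
  -- Cauchy–Schwarz: an isotropic vector of a semidefinite form lies in its kernel, here zero by the
  -- rank.
  have := LinearMap.BilinForm.apply_sq_le_of_symm (hankel σ B B h) hpos
    ⟨fun x y => hankel_congr σ h h (mul_comm _ _)⟩ p q
  rw [show hankel σ B B h p p = 0 from hp, zero_mul] at this
  exact pow_eq_zero_iff two_ne_zero |>.mp (le_antisymm this (sq_nonneg _))

/-- The coordinates, in a common eigenbasis of the operators `π ∘ xᵢ`, of the projection of a
polynomial are its values at the joint eigenvalues times the coordinates of the projection of `1`. -/
theorem repr_projection_eq_eval_mul {B : Finset (Fin n →₀ ℕ)} (hB : ConnectedToOne B)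
    (π : span (plus B) →ₗ[ℝ] span B) (hπ : ∀ s, π (inclPlus B s) = s)
    {κ : Type*} (b : Basis κ ℝ (span B)) (ζ : κ → Fin n → ℝ)
    (hζ : ∀ k i, π (mulX B i (b k)) = ζ k i • b k) (p : span (plus B)) (k : κ) :
    b.repr (π p) k = MvPolynomial.eval (ζ k) (p : MvPolynomial (Fin n) ℝ) *
      b.repr ⟨MvPolynomial.monomial 0 1, monomial_mem_span hB.1⟩ k := by
  have hmul : ∀ i s, b.repr (π (mulX B i s)) k = ζ k i * b.repr s k := by
    intro i s
    have : (b.coord k) ∘ₗ π ∘ₗ mulX B i = ζ k i • b.coord k := by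
      refine b.ext fun l => ?_
      by_cases h : l = k
      · subst h; simp [hζ]
      · simp [hζ, Finsupp.single_eq_of_ne' h]
    simpa using LinearMap.congr_fun this s
  -- Connectedness lets each monomial of B be reached from 1 inside B, one variable at a time.
  have hmon : ∀ (d : ℕ) (m : Fin n →₀ ℕ) (hm : m ∈ B), m.degree = d →
      b.repr ⟨MvPolynomial.monomial m 1, monomial_mem_span hm⟩ k =
        MvPolynomial.eval (ζ k) (MvPolynomial.monomial m (1 : ℝ)) *
          b.repr ⟨MvPolynomial.monomial 0 1, monomial_mem_span hB.1⟩ k := by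
    intro d
    induction d with
    | zero =>
      intro m hm hd
      obtain rfl : m = 0 := (Finsupp.degree_eq_zero_iff m).mp hd
      simp
    | succ d ih =>
      intro m hm hd
      obtain ⟨i, m', hm', rfl⟩ := hB.2 m hm (by rintro rfl; simp at hd)
      have h1 := ih m' hm' (by simp at hd; omega)
      have h2 : mulX B i ⟨_, monomial_mem_span hm'⟩ = inclPlus B ⟨_, monomial_mem_span hm⟩ :=
        Subtype.ext (monomial_single_add i m').symm
      rw [← hπ ⟨_, monomial_mem_span hm⟩, ← h2, hmul, h1, monomial_single_add, map_mul,
        MvPolynomial.eval_X, mul_assoc]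
  obtain ⟨p, hp⟩ := p
  induction hp using Submodule.span_induction with
  | mem x hx =>
    obtain ⟨m, hm, rfl⟩ := hx
    simp only [plus, Finset.coe_union, Set.mem_union, Finset.mem_coe, Finset.mem_biUnion,
      Finset.mem_image] at hm
    obtain hm | ⟨i, -, m', hm', rfl⟩ := hm
    · exact (congrArg (fun s => b.repr s k) (hπ ⟨_, monomial_mem_span hm⟩)).trans
        (hmon _ m hm rfl)
    · have h2 : mulX B i ⟨_, monomial_mem_span hm'⟩ =
          ⟨_, monomial_mem_span (single_add_mem_plus hm' i)⟩ :=
        Subtype.ext (monomial_single_add i m').symm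
      have h3 := hmul i ⟨_, monomial_mem_span hm'⟩
      rw [h2, hmon _ m' hm' rfl, ← mul_assoc] at h3
      simpa only [monomial_single_add, map_mul, MvPolynomial.eval_X] using h3
  | zero =>
    rw [show (⟨0, _⟩ : span (plus B)) = 0 from rfl]
    simp
  | add x y hx hy ihx ihy =>
    rw [show (⟨x + y, _⟩ : span (plus B)) = ⟨x, hx⟩ + ⟨y, hy⟩ from rfl, map_add, map_add,
      Finsupp.add_apply, ihx, ihy]
    simp [add_mul]
  | smul c x hx ih =>
    rw [show (⟨c • x, _⟩ : span (plus B)) = c • ⟨x, hx⟩ from rfl, map_smul, map_smul,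
      Finsupp.smul_apply, ih]
    simp [mul_assoc]

/-! ### Flat extension and the quadrature rule -/

/-- Flat extension: a linear form on `⟨B⁺ · B⁺⟩` with a flat positive Hankel operator is a positive
combination of evaluations at `|B|` distinct real points. -/
theorem exists_eq_sum_eval_of_flat {B : Finset (Fin n →₀ ℕ)} (hB : ConnectedToOne B)
    (σ : Dual ℝ (prodSpan (plus B) (plus B)))
    (hrank : (hankel σ B B (prodSpan_mono (subset_plus B) (subset_plus B))).rank = B.card)
    (hrank_plus : (hankel σ (plus B) (plus B) le_rfl).rank = B.card)
    (hpos : ∀ p : span B,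
      0 ≤ hankel σ B B (prodSpan_mono (subset_plus B) (subset_plus B)) p p) :
    ∃ (w : Fin B.card → ℝ) (ζ : Fin B.card → (Fin n → ℝ)),
      (∀ i, 0 < w i) ∧ Function.Injective ζ ∧
        ∀ v (hv : v ∈ prodSpan (plus B) (plus B)),
          σ ⟨v, hv⟩ = ∑ i, w i * MvPolynomial.eval (ζ i) v := by
  set H := hankel σ B B (prodSpan_mono (subset_plus B) (subset_plus B)) with hH
  set H' := hankel σ (plus B) (plus B) le_rfl with hH'
  have hdef : ∀ p, H p p = 0 → p = 0 := hankel_definite σ _ hrank hpos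
  have hS : finrank ℝ (span B) = B.card := by
    refine le_antisymm (finrank_span_le B) ?_
    have hr : finrank ℝ (LinearMap.range H) = B.card := finrank_eq_of_rank_eq hrank
    rw [← hr]
    exact LinearMap.finrank_range_le H
  have hincl : ∀ s t, H' (inclPlus B s) (inclPlus B t) = H s t := fun s t =>
    hankel_congr σ _ _ rfl
  obtain ⟨π, hπ, hπH⟩ := LinearMap.exists_projection_of_finrank_range_le H' (inclPlus B)
    (fun s hs => hdef s (by rwa [hincl] at hs))
    (by rw [hS]; exact (finrank_eq_of_rank_eq hrank_plus).le)
  have hsymm : ∀ s t, H s t = H t s := fun s t => hankel_congr σ _ _ (mul_comm _ _)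
  have hsymm' : ∀ s t, H' s t = H' t s := fun s t => hankel_congr σ _ _ (mul_comm _ _)
  have hHπ : ∀ p s, H (π p) s = H' p (inclPlus B s) := fun p s => by rw [← hincl, hπH]
  have hself : ∀ i x y, H (π (mulX B i x)) y = H x (π (mulX B i y)) := by
    intro i x y
    rw [hHπ, hsymm x, hHπ]
    exact hankel_congr σ _ _ (by rw [coe_mulX, coe_inclPlus, coe_mulX, coe_inclPlus]; ring)
  -- The right side is σ(xᵢxⱼxy), symmetric in `i` and `j`; definiteness then yields commutation.
  have hcross : ∀ i j x y,
      H (π (mulX B i (π (mulX B j x)))) y = H' (mulX B j x) (mulX B i y) := by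
    intro i j x y
    rw [hself, hsymm, hHπ, hsymm', hπH]
  have hcomm : ∀ i j x, π (mulX B i (π (mulX B j x))) = π (mulX B j (π (mulX B i x))) := by
    intro i j x
    rw [← sub_eq_zero]
    refine hdef _ ?_
    -- Only the first slot is expanded as a difference; the second keeps `z`, so `hcross` applies to
    -- both terms.
    generalize hz : π (mulX B i (π (mulX B j x))) - π (mulX B j (π (mulX B i x))) = z
    conv_lhs => enter [1]; rw [← hz]
    rw [map_sub, LinearMap.sub_apply, hcross, hcross, sub_eq_zero]
    exact hankel_congr σ _ _ (by rw [coe_mulX, coe_mulX, coe_mulX, coe_mulX]; ring)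
  obtain ⟨b, ζ, hb, hζ⟩ := LinearMap.exists_orthonormal_joint_eigenbasis hS H hsymm hpos hdef
    (fun i => π ∘ₗ mulX B i) hself hcomm
  set c : Fin B.card → ℝ :=
    fun k => b.repr ⟨MvPolynomial.monomial 0 1, monomial_mem_span hB.1⟩ k
  have hrepr : ∀ p k, b.repr (π p) k = MvPolynomial.eval (ζ k) p.1 * c k :=
    repr_projection_eq_eval_mul hB π hπ b ζ hζ
  -- The `b l` are, up to scaling, interpolation polynomials at the nodes; this forces `c k ≠ 0` and
  -- distinct nodes.
  have hbasis : ∀ l k, MvPolynomial.eval (ζ k) (b l).1 * c k = if l = k then 1 else 0 := by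
    intro l k
    rw [← Finsupp.single_apply, ← b.repr_self l]
    conv_rhs => rw [← hπ (b l)]
    exact (hrepr (inclPlus B (b l)) k).symm
  have hc : ∀ k, c k ≠ 0 := fun k hk => by simpa [hk] using hbasis k k
  have hexpand : ∀ x y, H x y = ∑ k, b.repr x k * b.repr y k := by
    intro x y
    conv_lhs => rw [← b.sum_repr x, ← b.sum_repr y]
    simp only [map_sum, map_smul, LinearMap.sum_apply, LinearMap.smul_apply, hb, smul_eq_mul,
      mul_ite, mul_one, mul_zero, Finset.sum_ite_eq', Finset.mem_univ, if_true]
    exact Finset.sum_congr rfl fun k _ => mul_comm _ _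
  refine ⟨fun k => c k ^ 2, ζ, fun k => sq_pos_of_ne_zero (hc k), fun k l hkl => ?_,
    fun v hv => ?_⟩
  · by_contra hne
    have h0 : MvPolynomial.eval (ζ l) (b k).1 = 0 := by
      simpa [hne, hc l] using hbasis k l
    have h1 := hbasis k k
    rw [hkl, h0] at h1
    simp at h1
  · induction hv using Submodule.mul_induction_on' with
    | mem_mul_mem p hp q hq =>
      calc _ = H' ⟨p, hp⟩ ⟨q, hq⟩ := rfl
        _ = H (π ⟨p, hp⟩) (π ⟨q, hq⟩) := by
          rw [hHπ, hsymm' _ (inclPlus B _), hπH, hsymm']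
        _ = _ := by
          rw [hexpand]
          refine Finset.sum_congr rfl fun k _ => ?_
          rw [hrepr, hrepr, map_mul]
          ring
    | add x hx y hy ihx ihy =>
      rw [show (⟨x + y, _⟩ : prodSpan (plus B) (plus B)) = ⟨x, hx⟩ + ⟨y, hy⟩ from rfl, map_add,
        ihx, ihy, ← Finset.sum_add_distrib]
      simp [mul_add]

end MonomialSet

theorem mainTheorem8 {n r : ℕ}
    -- the integral `I` has a positive weight `ω` on `Ω` and is defined on `V`
    (Ω : Set (Fin n → ℝ)) (hΩ : MeasurableSet Ω)
    (ω : (Fin n → ℝ) → ℝ) (hω : ∀ x ∈ Ω, 0 < ω x)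
    (V : Submodule ℝ (MvPolynomial (Fin n) ℝ)) (hV : FiniteDimensional ℝ V)
    (hint : ∀ v ∈ V, IntegrableOn (fun x => ω x * MvPolynomial.eval x v) Ω)
    (B : Finset (Fin n →₀ ℕ)) (hB : MonomialSet.ConnectedToOne B)
    (hVB : V ≤ MonomialSet.prodSpan (MonomialSet.plus B) (MonomialSet.plus B))
    (σ : Module.Dual ℝ (MonomialSet.prodSpan (MonomialSet.plus B) (MonomialSet.plus B)))
    (hσI : ∀ v (hv : v ∈ V),
      σ ⟨v, hVB hv⟩ = weightedIntegral Ω ω (fun x => MvPolynomial.eval x v))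
    (hcard : B.card = r)
    (hrank : (MonomialSet.hankel σ B B
      (MonomialSet.prodSpan_mono (MonomialSet.subset_plus B) (MonomialSet.subset_plus B))).rank = r)
    (hrank_plus : (MonomialSet.hankel σ (MonomialSet.plus B) (MonomialSet.plus B) le_rfl).rank = r)
    -- `H_σ^{B,B} ≽ 0`
    (hpos : ∀ p : MonomialSet.span B, 0 ≤ MonomialSet.hankel σ B B
      (MonomialSet.prodSpan_mono (MonomialSet.subset_plus B) (MonomialSet.subset_plus B)) p p) :
    ∃ (w : Fin r → ℝ) (ζ : Fin r → (Fin n → ℝ)),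
      (∀ i, 0 < w i) ∧ Function.Injective ζ ∧
        ∀ v ∈ V, weightedIntegral Ω ω (fun x => MvPolynomial.eval x v) =
          ∑ i, w i * MvPolynomial.eval (ζ i) v := by
  subst hcard
  obtain ⟨w, ζ, hw, hζ, h⟩ := MonomialSet.exists_eq_sum_eval_of_flat hB σ hrank hrank_plus hpos
  exact ⟨w, ζ, hw, hζ, fun v hv => by rw [← hσI v hv, h v (hVB hv)]⟩
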